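/- Let $\mathcal U_i,\mathcal X_i,\mathcal Y_i$ ($i=1,2$) be finite alphabets, let $p_{\rm s}$ be a probability distribution on $\mathcal U_1\times\mathcal U_2$, let $p(y_1,y_2|x_1,x_2)$ be the transition probabilities of a memoryless two-way channel with inputs $x_i\in\mathcal X_i$ and outputs $y_i\in\mathcal Y_i$, let $d_i:\mathcal U_i\times\mathcal U_i\to\mathbb R$ be distortion measures, and let $r>0$ and $D_1,D_2$ be real numbers. A code with $K$ source symbols and $N\ge 1$ channel uses consists of encoders $f_{in}:\mathcal U_i^K\times\mathcal Y_i^{n-1}\to\mathcal X_i$ ($i=1,2$, $1\le n\le N$) and decoders $g_i:\mathcal U_i^K\times\mathcal Y_i^N\to\mathcal U_j^K$ ($j\ne i$). With $X_{in}=f_{in}(U_i^K,Y_i^{n-1})$, the joint distribution of sources and channel outputs is $$p(u_1^K,u_2^K,y_1^N,y_2^N)=\prod_{m=1}^K p_{\rm s}(u_{1m},u_{2m})\prod_{n=1}^N p(y_{1n},y_{2n}|x_{1n},x_{2n}),$$ the estimate of $U_j^K$ is $\hat U_j^K=g_i(U_i^K,Y_i^N)$, and the expected distortions are $D_{f_i}=K^{-1}\sum_{m=1}^K\mathbb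 E[d_i(U_{im},\hat U_{im})]$. The pair $(D_1,D_2)$ is achievable at rate $r$ if there are codes, one for each $K$, with $K$ source symbols and $N_K$ channel uses such that $K/N_K\to r$ and $\limsup_{K\to\infty}D_{f_i}\le D_i$ for $i=1,2$. Let $$R^{(i)}(D)=\inf\{I(U_i;\hat U_i): p(\hat u_i|u_i)\text{ a conditional distribution on }\mathcal U_i\text{ with }\mathbb E[d_i(U_i,\hat U_i)]\le D\}$$ be the rate-distortion function of $U_i$, where $(U_1,U_2)\sim p_{\rm s}$ (and $\inf\emptyset=+\infty$). If $(D_1,D_2)$ is achievable at rate $r$, then there is a probability distribution $p(x_1,x_2)$ on $\mathcal X_1\times\mathcal X_2$ such that both $$R^{(1)}(D_1)\le I(U_1;U_2)+r^{-1}I(X_1;Y_2|X_2)\quad\text{and}\quad R^{(2)}(D_2)\le I(U_1;U_2)+r^{-1}I(X_2;Y_1|X_1),$$ where $(U_1,U_2)\sim p_{\rm s}$ and $(X_1,X_2,Y_1,Y_2)\sim p(x_1,x_2)\,p(y_1,y_2|x_1,x_2)$, and $(U_1,U_2)$ is independent of $(X_1,X_2)$. -/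

import Mathlib

noncomputable section

open scoped Classical in
/-- The probability mass function of the random variable `X` when the outcomes in the finite
sample space `Ω` have the probabilities `q`. -/
def TWC.law {Ω α : Type*} [Fintype Ω] (q : Ω → ℝ) (X : Ω → α) (a : α) : ℝ :=
  ∑ ω : Ω, if X ω = a then q ω else 0

/-- Mutual information `I(X;Y)` (in nats) of finite-valued random variables `X`, `Y` on the finite
probability space `(Ω, q)`. Terms of probability zero vanish. -/
def TWC.mutualInfo {Ω α β : Type*} [Fintype Ω] [Fintype α] [Fintype β]
    (q : Ω → ℝ) (X : Ω → α) (Y : Ω → β) : ℝ :=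
  ∑ a : α, ∑ b : β, TWC.law q (fun ω => (X ω, Y ω)) (a, b) *
    Real.log (TWC.law q (fun ω => (X ω, Y ω)) (a, b) / (TWC.law q X a * TWC.law q Y b))

/-- Conditional mutual information `I(X;Y|Z)` (in nats) of finite-valued random variables on the
finite probability space `(Ω, q)`, that is, the expectation of
`log (p(X,Y,Z) p(Z) / (p(X,Z) p(Y,Z)))`. Terms of probability zero vanish. -/
def TWC.condMutualInfo {Ω α β γ : Type*} [Fintype Ω] [Fintype α] [Fintype β] [Fintype γ]
    (q : Ω → ℝ) (X : Ω → α) (Y : Ω → β) (Z : Ω → γ) : ℝ :=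
  ∑ a : α, ∑ b : β, ∑ c : γ, TWC.law q (fun ω => (X ω, Y ω, Z ω)) (a, b, c) *
    Real.log (TWC.law q (fun ω => (X ω, Y ω, Z ω)) (a, b, c) * TWC.law q Z c /
      (TWC.law q (fun ω => (X ω, Z ω)) (a, c) * TWC.law q (fun ω => (Y ω, Z ω)) (b, c)))

/-- The rate-distortion function `R(D)` of a source with distribution `pU` on the finite alphabet
`U` and distortion measure `d`: the infimum of `I(U;Û)` over all conditional distributions
`V u û = p(û|u)` with `E[d(U,Û)] ≤ D`. It is `⊤` if no conditional distribution meets the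
distortion constraint. -/
def TWC.rateDistortion {U : Type*} [Fintype U] (pU : U → ℝ) (d : U → U → ℝ) (D : ℝ) : EReal :=
  ⨅ (V : U → U → ℝ) (_ : ∀ u, V u ∈ stdSimplex ℝ U)
    (_ : ∑ u : U, ∑ v : U, pU u * V u v * d u v ≤ D),
    ((TWC.mutualInfo (fun w : U × U => pU w.1 * V w.1 w.2) Prod.fst Prod.snd : ℝ) : EReal)

/-- The joint distribution of `((X₁, X₂), (Y₁, Y₂))` when the pair of inputs with distribution `p`
is sent over the two-way channel with transition probabilities `W x y = p(y₁, y₂ | x₁, x₂)`. -/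
def TWC.inputOutput {X₁ X₂ Y₁ Y₂ : Type*} (p : X₁ × X₂ → ℝ) (W : X₁ × X₂ → Y₁ × Y₂ → ℝ) :
    (X₁ × X₂) × (Y₁ × Y₂) → ℝ :=
  fun w => p w.1 * W w.1 w.2

/-- A two-way source-channel code with `K` source symbols and `N` channel uses at each terminal.
The input of a terminal at time `n` (times are numbered from `0`) is a function of its own
source sequence and of the `n` channel outputs that it received before. Each terminal estimates
the source sequence of the other one from its own source sequence and all its channel outputs. -/
structure TWC.Code (U₁ U₂ X₁ X₂ Y₁ Y₂ : Type*) (K N : ℕ) where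
  enc₁ : (n : Fin N) → (Fin K → U₁) → (Fin (n : ℕ) → Y₁) → X₁
  enc₂ : (n : Fin N) → (Fin K → U₂) → (Fin (n : ℕ) → Y₂) → X₂
  dec₁ : (Fin K → U₁) → (Fin N → Y₁) → (Fin K → U₂)
  dec₂ : (Fin K → U₂) → (Fin N → Y₂) → (Fin K → U₁)

/-- The outputs received before time `n`. -/
def TWC.past {Y : Type*} {N : ℕ} (y : Fin N → Y) (n : Fin N) : Fin (n : ℕ) → Y :=
  fun j => y (Fin.castLE n.isLt.le j)

/-- Outcomes of a transmission: the source sequences `(u₁, u₂)` and the output sequences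
`(y₁, y₂)`. The input sequences are functions of these. -/
abbrev TWC.Outcome (U₁ U₂ Y₁ Y₂ : Type*) (K N : ℕ) : Type _ :=
  ((Fin K → U₁) × (Fin K → U₂)) × ((Fin N → Y₁) × (Fin N → Y₂))

section Transmission

variable {U₁ U₂ X₁ X₂ Y₁ Y₂ : Type*} {K N : ℕ}

/-- The pair of channel inputs at time `n`. -/
def TWC.Code.input (c : TWC.Code U₁ U₂ X₁ X₂ Y₁ Y₂ K N) (ω : TWC.Outcome U₁ U₂ Y₁ Y₂ K N)
    (n : Fin N) : X₁ × X₂ :=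
  (c.enc₁ n ω.1.1 (TWC.past ω.2.1 n), c.enc₂ n ω.1.2 (TWC.past ω.2.2 n))

/-- The probability of an outcome: the source pairs are i.i.d. with distribution `ps`, and the
channel `W` is memoryless. -/
def TWC.Code.prob (c : TWC.Code U₁ U₂ X₁ X₂ Y₁ Y₂ K N) (ps : U₁ × U₂ → ℝ)
    (W : X₁ × X₂ → Y₁ × Y₂ → ℝ) (ω : TWC.Outcome U₁ U₂ Y₁ Y₂ K N) : ℝ :=
  (∏ m : Fin K, ps (ω.1.1 m, ω.1.2 m)) * ∏ n : Fin N, W (c.input ω n) (ω.2.1 n, ω.2.2 n)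

/-- The distortion between two sequences of length `K`. -/
def TWC.seqDistortion {U : Type*} (d : U → U → ℝ) (u v : Fin K → U) : ℝ :=
  (K : ℝ)⁻¹ * ∑ m : Fin K, d (u m) (v m)

variable [Fintype U₁] [Fintype U₂] [Fintype Y₁] [Fintype Y₂]

/-- The expected distortion of the estimate of the first source at terminal 2. -/
def TWC.Code.distortion₁ (c : TWC.Code U₁ U₂ X₁ X₂ Y₁ Y₂ K N) (ps : U₁ × U₂ → ℝ)
    (W : X₁ × X₂ → Y₁ × Y₂ → ℝ) (d₁ : U₁ → U₁ → ℝ) : ℝ :=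
  ∑ ω : TWC.Outcome U₁ U₂ Y₁ Y₂ K N,
    c.prob ps W ω * TWC.seqDistortion d₁ ω.1.1 (c.dec₂ ω.1.2 ω.2.2)

/-- The expected distortion of the estimate of the second source at terminal 1. -/
def TWC.Code.distortion₂ (c : TWC.Code U₁ U₂ X₁ X₂ Y₁ Y₂ K N) (ps : U₁ × U₂ → ℝ)
    (W : X₁ × X₂ → Y₁ × Y₂ → ℝ) (d₂ : U₂ → U₂ → ℝ) : ℝ :=
  ∑ ω : TWC.Outcome U₁ U₂ Y₁ Y₂ K N,
    c.prob ps W ω * TWC.seqDistortion d₂ ω.1.2 (c.dec₁ ω.1.1 ω.2.1)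

/-- The distortion pair `(D₁, D₂)` is achievable at rate `r`: there are codes with `K` source
symbols and `N K` channel uses, for each `K`, such that `K / N K → r` and the upper limits of
the expected distortions are at most `D₁` and `D₂`. -/
def TWC.Achievable (ps : U₁ × U₂ → ℝ) (W : X₁ × X₂ → Y₁ × Y₂ → ℝ)
    (d₁ : U₁ → U₁ → ℝ) (d₂ : U₂ → U₂ → ℝ) (r D₁ D₂ : ℝ) : Prop :=
  ∃ (N : ℕ → ℕ) (c : (K : ℕ) → TWC.Code U₁ U₂ X₁ X₂ Y₁ Y₂ K (N K)),
    (∀ K, 0 < N K) ∧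
    Filter.Tendsto (fun K : ℕ => (K : ℝ) / (N K : ℝ)) Filter.atTop (nhds r) ∧
    Filter.limsup (fun K => (((c K).distortion₁ ps W d₁ : ℝ) : EReal)) Filter.atTop ≤ (D₁ : EReal) ∧
    Filter.limsup (fun K => (((c K).distortion₂ ps W d₂ : ℝ) : EReal)) Filter.atTop ≤ (D₂ : EReal)

end Transmission

end

/-!
Write `P` for the law of a transmission. All sums of letters are read off at a uniformly random
time `T` that is independent of the transmission; then `(U₁T, U₂T)` has the law `ps`, and
`(X_T, Y_T)` is an input-output pair of the channel.

For one code and the estimate `Û₁` of `U₁` at terminal 2, draw instead `U₂` i.i.d., then `Y₂` from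
`p(y₂|x₂)`, which determines `Û₁`, then `U₁` from `p(u₁|û₁)` and at last `Y₁` from
`p(y₁|x₁,y₂,x₂)`. This gives a measure `Q` of mass at most one, and on the support of `P` the
quantity `log (P / Q)` is a sum of the information densities of
`I(U₁;U₂) - I(U₁;Û₁)` over the source letters and of those of `I(X₁;Y₂|X₂)` over the channel uses.
Hence Gibbs' inequality gives `K I(U₁T;Û₁T) ≤ K I(U₁;U₂) + N I(X₁T;Y₂T|X₂T)`, which bounds the
rate-distortion function at the distortion of the code. Both directions involve the same law of
`X_T`, and a limit point of these laws as `K → ∞` is the required input distribution, because the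
rate-distortion function is lower semicontinuous.
-/

namespace TWC

section Law

variable {Ω α β γ : Type*} [Fintype Ω] {q : Ω → ℝ}

theorem law_nonneg (hq : ∀ ω, 0 ≤ q ω) (X : Ω → α) (a : α) : 0 ≤ law q X a :=
  Finset.sum_nonneg fun ω _ => by split_ifs <;> simp [hq]

theorem law_pos (hq : ∀ ω, 0 ≤ q ω) (X : Ω → α) {ω : Ω} (hω : 0 < q ω) : 0 < law q X (X ω) :=
  Finset.sum_pos' (fun ω' _ => by split_ifs <;> simp [hq])
    ⟨ω, Finset.mem_univ ω, by simpa using hω⟩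

theorem sum_law_mul [Fintype α] (q : Ω → ℝ) (X : Ω → α) (f : α → ℝ) :
    ∑ a, law q X a * f a = ∑ ω, q ω * f (X ω) := by
  classical
  simp only [law, Finset.sum_mul, ite_mul, zero_mul]
  rw [Finset.sum_comm]
  simp

theorem sum_law [Fintype α] (q : Ω → ℝ) (X : Ω → α) : ∑ a, law q X a = ∑ ω, q ω := by
  simpa using sum_law_mul q X fun _ => 1

theorem law_mem_stdSimplex [Fintype α] (hq : q ∈ stdSimplex ℝ Ω) (X : Ω → α) :
    law q X ∈ stdSimplex ℝ α :=
  ⟨law_nonneg hq.1 X, (sum_law q X).trans hq.2⟩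

theorem law_law [Fintype α] (q : Ω → ℝ) (X : Ω → α) (f : α → β) :
    law (law q X) f = law q fun ω => f (X ω) := by
  classical
  funext b
  simpa [law] using sum_law_mul q X fun a => if f a = b then 1 else 0

theorem sum_law_pair [Fintype α] (q : Ω → ℝ) (X : Ω → α) (Y : Ω → β) (b : β) :
    ∑ a, law q (fun ω => (X ω, Y ω)) (a, b) = law q Y b := by
  classical
  simp only [law, Prod.mk.injEq]
  rw [Finset.sum_comm]
  simp [ite_and]

theorem law_injective_comp {f : α → β} (hf : f.Injective) (q : Ω → ℝ) (X : Ω → α) (a : α) :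
    law q (fun ω => f (X ω)) (f a) = law q X a := by
  classical
  simp only [law, hf.eq_iff]

theorem law_fst [Fintype α] [Fintype β] (q : α × β → ℝ) (a : α) :
    law q Prod.fst a = ∑ b, q (a, b) := by
  classical
  simp only [law, Fintype.sum_prod_type]
  rw [Finset.sum_comm]
  simp

theorem comp_equiv_eq_law (e : α ≃ Ω) (q : Ω → ℝ) :
    (fun a => q (e a)) = law q e.symm := by
  classical
  funext a
  simp [law, e.symm_apply_eq]

theorem continuous_law (X : Ω → α) (a : α) : Continuous fun q : Ω → ℝ => law q X a := by
  classical
  refine continuous_finsetSum _ fun ω _ => ?_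
  split_ifs <;> fun_prop

/-- The conditional probability mass function `condLaw q X Y b a = P(X = a | Y = b)`. It vanishes
if `Y = b` has probability zero. -/
noncomputable def condLaw (q : Ω → ℝ) (X : Ω → α) (Y : Ω → β) (b : β) (a : α) : ℝ :=
  law q (fun ω => (X ω, Y ω)) (a, b) / law q Y b

variable {ι : Type*} [Fintype ι]

/-- The law of `(ω, i)`, where `ω` has the law `q` and `i` is independent of it and uniform on
`ι`. With `ι` a set of times, this introduces the time-sharing variable. -/
noncomputable def prodUniform (q : Ω → ℝ) (ι : Type*) [Fintype ι] (w : Ω × ι) : ℝ :=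
  q w.1 / Fintype.card ι

omit [Fintype Ω] in
theorem prodUniform_nonneg (hq : ∀ ω, 0 ≤ q ω) (w : Ω × ι) : 0 ≤ prodUniform q ι w :=
  div_nonneg (hq _) (Nat.cast_nonneg _)

omit [Fintype Ω] in
theorem prodUniform_pos {ω : Ω} (hω : 0 < q ω) (i : ι) : 0 < prodUniform q ι (ω, i) :=
  div_pos hω (Nat.cast_pos.2 (Fintype.card_pos_iff.2 ⟨i⟩))

theorem card_mul_sum_prodUniform_mul (q : Ω → ℝ) (f : Ω × ι → ℝ) :
    (Fintype.card ι : ℝ) * ∑ w, prodUniform q ι w * f w = ∑ ω, q ω * ∑ i, f (ω, i) := by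
  cases isEmpty_or_nonempty ι
  · simp
  · simp only [Fintype.sum_prod_type, prodUniform, Finset.mul_sum]
    refine Finset.sum_congr rfl fun ω _ => Finset.sum_congr rfl fun i _ => ?_
    field_simp

theorem prodUniform_mem_stdSimplex [Nonempty ι] (hq : q ∈ stdSimplex ℝ Ω) :
    prodUniform q ι ∈ stdSimplex ℝ (Ω × ι) := by
  refine ⟨prodUniform_nonneg hq.1, ?_⟩
  simp only [Fintype.sum_prod_type, prodUniform, Finset.sum_const, Finset.card_univ, nsmul_eq_mul]
  field_simp
  exact hq.2

theorem law_prodUniform (q : Ω → ℝ) (X : Ω × ι → α) (a : α) :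
    law (prodUniform q ι) X a = (∑ i, law q (fun ω => X (ω, i)) a) / Fintype.card ι := by
  simp only [law, prodUniform, Fintype.sum_prod_type, Finset.sum_div]
  rw [Finset.sum_comm]
  simp only [ite_div, zero_div]

end Law

section Information

variable {Ω α β γ δ : Type*} [Fintype Ω] {q : Ω → ℝ}

/-- The information density of `I(X;Y)`: the random variable with expectation `I(X;Y)` that is
added up along a transmission. -/
noncomputable def infoDensity (q : Ω → ℝ) (X : Ω → α) (Y : Ω → β) (ω : Ω) : ℝ :=
  Real.log (law q (fun ω => (X ω, Y ω)) (X ω, Y ω) / (law q X (X ω) * law q Y (Y ω)))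

/-- The information density of `I(X;Y|Z)`, the conditional analogue of `infoDensity`. -/
noncomputable def condInfoDensity (q : Ω → ℝ) (X : Ω → α) (Y : Ω → β) (Z : Ω → γ) (ω : Ω) : ℝ :=
  Real.log (law q (fun ω => (X ω, Y ω, Z ω)) (X ω, Y ω, Z ω) * law q Z (Z ω) /
    (law q (fun ω => (X ω, Z ω)) (X ω, Z ω) * law q (fun ω => (Y ω, Z ω)) (Y ω, Z ω)))

theorem law_mul_exp_infoDensity_sub (hq : ∀ ω, 0 ≤ q ω) (X : Ω → α) (Y : Ω → β) (Z : Ω → γ)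
    {ω : Ω} (hω : 0 < q ω) :
    law q (fun ω => (X ω, Y ω)) (X ω, Y ω) * Real.exp (infoDensity q X Z ω - infoDensity q X Y ω) =
      condLaw q X Z (Z ω) (X ω) * law q Y (Y ω) := by
  have hX := law_pos hq X hω
  have hY := law_pos hq Y hω
  have hZ := law_pos hq Z hω
  have hXY := law_pos hq (fun ω => (X ω, Y ω)) hω
  have hXZ := law_pos hq (fun ω => (X ω, Z ω)) hω
  rw [Real.exp_sub, infoDensity, infoDensity, Real.exp_log (by positivity),
    Real.exp_log (by positivity), condLaw]
  field_simp

theorem condLaw_mul_exp_neg_condInfoDensity (hq : ∀ ω, 0 ≤ q ω) (T : Ω → δ) (X : Ω → α)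
    (Y : Ω → β) (Z : Ω → γ) {ω : Ω} (hω : 0 < q ω) :
    condLaw q (fun ω => (T ω, Y ω)) (fun ω => (X ω, Z ω)) (X ω, Z ω) (T ω, Y ω) *
        Real.exp (-condInfoDensity q X Y Z ω) =
      condLaw q T (fun ω => (X ω, Y ω, Z ω)) (X ω, Y ω, Z ω) (T ω) *
        condLaw q Y Z (Z ω) (Y ω) := by
  have hZ := law_pos hq Z hω
  have hXZ := law_pos hq (fun ω => (X ω, Z ω)) hω
  have hYZ := law_pos hq (fun ω => (Y ω, Z ω)) hω
  have hXYZ := law_pos hq (fun ω => (X ω, Y ω, Z ω)) hω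
  have hjoint : law q (fun ω => ((T ω, Y ω), (X ω, Z ω))) ((T ω, Y ω), (X ω, Z ω)) =
      law q (fun ω => (T ω, X ω, Y ω, Z ω)) (T ω, X ω, Y ω, Z ω) :=
    law_injective_comp (f := fun w : δ × α × β × γ => ((w.1, w.2.2.1), (w.2.1, w.2.2.2)))
      (fun v w h => by grind) q (fun ω => (T ω, X ω, Y ω, Z ω)) (T ω, X ω, Y ω, Z ω)
  rw [Real.exp_neg, condInfoDensity, Real.exp_log (by positivity), condLaw, condLaw, condLaw,
    hjoint]
  field_simp

variable [Fintype α] [Fintype β] [Fintype γ]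

theorem mutualInfo_eq_sum (q : Ω → ℝ) (X : Ω → α) (Y : Ω → β) :
    mutualInfo q X Y = ∑ ω, q ω * infoDensity q X Y ω := by
  simp only [mutualInfo, infoDensity]
  rw [← sum_law_mul q (fun ω => (X ω, Y ω)) fun w =>
    Real.log (law q (fun ω => (X ω, Y ω)) w / (law q X w.1 * law q Y w.2)), Fintype.sum_prod_type]

theorem condMutualInfo_eq_sum (q : Ω → ℝ) (X : Ω → α) (Y : Ω → β) (Z : Ω → γ) :
    condMutualInfo q X Y Z = ∑ ω, q ω * condInfoDensity q X Y Z ω := by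
  simp only [condMutualInfo, condInfoDensity]
  rw [← sum_law_mul q (fun ω => (X ω, Y ω, Z ω)) fun w =>
    Real.log (law q (fun ω => (X ω, Y ω, Z ω)) w * law q Z w.2.2 /
      (law q (fun ω => (X ω, Z ω)) (w.1, w.2.2) * law q (fun ω => (Y ω, Z ω)) (w.2.1, w.2.2)))]
  simp only [Fintype.sum_prod_type]

theorem mutualInfo_comm (q : Ω → ℝ) (X : Ω → α) (Y : Ω → β) :
    mutualInfo q X Y = mutualInfo q Y X := by
  have hswap (a : α) (b : β) : law q (fun ω => (Y ω, X ω)) (b, a) =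
      law q (fun ω => (X ω, Y ω)) (a, b) :=
    law_injective_comp Prod.swap_injective q (fun ω => (X ω, Y ω)) (a, b)
  simp only [mutualInfo, hswap, mul_comm (law q Y _)]
  exact Finset.sum_comm

theorem mutualInfo_law [Fintype δ] (q : Ω → ℝ) (S : Ω → δ) (X : δ → α) (Y : δ → β) :
    mutualInfo (law q S) X Y = mutualInfo q (fun ω => X (S ω)) fun ω => Y (S ω) := by
  simp only [mutualInfo, law_law]

theorem condMutualInfo_law [Fintype δ] (q : Ω → ℝ) (S : Ω → δ) (X : δ → α) (Y : δ → β)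
    (Z : δ → γ) :
    condMutualInfo (law q S) X Y Z =
      condMutualInfo q (fun ω => X (S ω)) (fun ω => Y (S ω)) fun ω => Z (S ω) := by
  simp only [condMutualInfo, law_law]

/-- The Shannon entropy `H(X)` in nats. In terms of entropies, mutual informations are seen to be
continuous in the law. -/
noncomputable def entropy (q : Ω → ℝ) (X : Ω → α) : ℝ := ∑ a, Real.negMulLog (law q X a)

theorem entropy_eq_sum (q : Ω → ℝ) (X : Ω → α) :
    entropy q X = ∑ ω, q ω * -Real.log (law q X (X ω)) := by
  rw [← sum_law_mul q X fun a => -Real.log (law q X a)]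
  simp [entropy, Real.negMulLog]

theorem continuous_entropy (X : Ω → α) : Continuous fun q : Ω → ℝ => entropy q X :=
  continuous_finsetSum _ fun a _ => Real.continuous_negMulLog.comp (continuous_law X a)

theorem mutualInfo_eq_entropy (hq : ∀ ω, 0 ≤ q ω) (X : Ω → α) (Y : Ω → β) :
    mutualInfo q X Y = entropy q X + entropy q Y - entropy q fun ω => (X ω, Y ω) := by
  simp only [mutualInfo_eq_sum, entropy_eq_sum, ← Finset.sum_add_distrib, ← Finset.sum_sub_distrib]
  refine Finset.sum_congr rfl fun ω _ => ?_
  rcases (hq ω).eq_or_lt with hω | hω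
  · simp [← hω]
  · have hX := law_pos hq X hω
    have hY := law_pos hq Y hω
    have hXY := law_pos hq (fun ω => (X ω, Y ω)) hω
    rw [infoDensity, Real.log_div hXY.ne' (by positivity), Real.log_mul hX.ne' hY.ne']
    ring

theorem condMutualInfo_eq_entropy (hq : ∀ ω, 0 ≤ q ω) (X : Ω → α) (Y : Ω → β) (Z : Ω → γ) :
    condMutualInfo q X Y Z = entropy q (fun ω => (X ω, Z ω)) + entropy q (fun ω => (Y ω, Z ω)) -
      entropy q (fun ω => (X ω, Y ω, Z ω)) - entropy q Z := by
  simp only [condMutualInfo_eq_sum, entropy_eq_sum, ← Finset.sum_add_distrib,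
    ← Finset.sum_sub_distrib]
  refine Finset.sum_congr rfl fun ω _ => ?_
  rcases (hq ω).eq_or_lt with hω | hω
  · simp [← hω]
  · have hZ := law_pos hq Z hω
    have hXZ := law_pos hq (fun ω => (X ω, Z ω)) hω
    have hYZ := law_pos hq (fun ω => (Y ω, Z ω)) hω
    have hXYZ := law_pos hq (fun ω => (X ω, Y ω, Z ω)) hω
    rw [condInfoDensity, Real.log_div (by positivity) (by positivity),
      Real.log_mul hXZ.ne' hYZ.ne', Real.log_mul hXYZ.ne' hZ.ne']
    ring

theorem continuousOn_mutualInfo (X : Ω → α) (Y : Ω → β) :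
    ContinuousOn (fun q : Ω → ℝ => mutualInfo q X Y) (Set.Ici 0) :=
  (((continuous_entropy X).add (continuous_entropy Y)).sub
    (continuous_entropy _)).continuousOn.congr fun _ hq => mutualInfo_eq_entropy hq X Y

theorem continuousOn_condMutualInfo (X : Ω → α) (Y : Ω → β) (Z : Ω → γ) :
    ContinuousOn (fun q : Ω → ℝ => condMutualInfo q X Y Z) (Set.Ici 0) :=
  ((((continuous_entropy _).add (continuous_entropy _)).sub (continuous_entropy _)).sub
    (continuous_entropy Z)).continuousOn.congr fun _ hq => condMutualInfo_eq_entropy hq X Y Z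

end Information

/-- Gibbs' inequality for the density `exp Z` of `P` with respect to a measure below `Q`. -/
theorem sum_mul_nonneg_of_mul_exp_neg_le {ι : Type*} [Fintype ι] {P Q Z : ι → ℝ}
    (hP : ∀ i, 0 ≤ P i) (hQP : ∑ i, Q i ≤ ∑ i, P i) (hZ : ∀ i, P i * Real.exp (-Z i) ≤ Q i) :
    0 ≤ ∑ i, P i * Z i := by
  have hterm (i : ι) : P i - Q i ≤ P i * Z i := by
    nlinarith [hZ i, mul_le_mul_of_nonneg_left (Real.add_one_le_exp (-Z i)) (hP i)]
  calc 0 ≤ ∑ i, (P i - Q i) := by rw [Finset.sum_sub_distrib]; linarith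
    _ ≤ ∑ i, P i * Z i := Finset.sum_le_sum fun i _ => hterm i

section RateDistortion

open Filter Topology

theorem exists_mem_stdSimplex_sum_mul_eq {β : Type*} [Fintype β] [Nonempty β] {f : β → ℝ}
    (hf : ∀ b, 0 ≤ f b) : ∃ v ∈ stdSimplex ℝ β, ∀ b, (∑ b', f b') * v b = f b := by
  classical
  rcases (Finset.sum_nonneg fun b _ => hf b).eq_or_lt with h | h
  · have hzero (b : β) : f b = 0 :=
      (Finset.sum_eq_zero_iff_of_nonneg fun b _ => hf b).1 h.symm b (Finset.mem_univ b)
    exact ⟨_, single_mem_stdSimplex ℝ (Classical.arbitrary β), fun b => by simp [hzero]⟩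
  · refine ⟨fun b => f b / ∑ b', f b', ⟨fun b => div_nonneg (hf b) h.le, ?_⟩, fun b => ?_⟩
    · rw [← Finset.sum_div, div_self h.ne']
    · exact mul_div_cancel₀ _ h.ne'

variable {U : Type*} [Fintype U] {pU : U → ℝ} {d : U → U → ℝ} {D b : ℝ}

/-- The conditional distributions that meet the constraint `E[d(U,Û)] ≤ D`: the set over which
`rateDistortion` is an infimum. -/
def testChannels (pU : U → ℝ) (d : U → U → ℝ) (D : ℝ) : Set (U → U → ℝ) :=
  {V | (∀ u, V u ∈ stdSimplex ℝ U) ∧ ∑ u, ∑ v, pU u * V u v * d u v ≤ D}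

theorem isCompact_setOf_forall_mem_stdSimplex (ι κ : Type*) [Fintype κ] :
    IsCompact {V : ι → κ → ℝ | ∀ i, V i ∈ stdSimplex ℝ κ} := by
  simpa only [Set.pi, Set.mem_univ, true_implies] using
    isCompact_univ_pi fun _ : ι => isCompact_stdSimplex ℝ κ

theorem isCompact_testChannels (pU : U → ℝ) (d : U → U → ℝ) (D : ℝ) :
    IsCompact (testChannels pU d D) := by
  have hcost : Continuous fun V : U → U → ℝ => ∑ u, ∑ v, pU u * V u v * d u v := by fun_prop
  exact (isCompact_setOf_forall_mem_stdSimplex U U).inter_right (isClosed_le hcost continuous_const)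

theorem continuousOn_mutualInfo_testChannel (hpU : ∀ u, 0 ≤ pU u) :
    ContinuousOn
      (fun V : U → U → ℝ => mutualInfo (fun w : U × U => pU w.1 * V w.1 w.2) Prod.fst Prod.snd)
      {V | ∀ u, V u ∈ stdSimplex ℝ U} := by
  have hjoint : Continuous fun (V : U → U → ℝ) (w : U × U) => pU w.1 * V w.1 w.2 := by fun_prop
  exact (continuousOn_mutualInfo Prod.fst Prod.snd).comp hjoint.continuousOn
    fun V hV w => mul_nonneg (hpU _) ((hV _).1 _)

theorem rateDistortion_le_coe_iff (hpU : ∀ u, 0 ≤ pU u) :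
    rateDistortion pU d D ≤ (b : EReal) ↔ ∃ V ∈ testChannels pU d D,
      mutualInfo (fun w : U × U => pU w.1 * V w.1 w.2) Prod.fst Prod.snd ≤ b := by
  constructor
  · intro h
    have hne : (testChannels pU d D).Nonempty := by
      by_contra hempty
      have htop : rateDistortion pU d D = ⊤ :=
        iInf_eq_top.2 fun V => iInf_eq_top.2 fun hV => iInf_eq_top.2 fun hVD =>
          (hempty ⟨V, hV, hVD⟩).elim
      exact (EReal.coe_lt_top b).not_ge (htop ▸ h)
    obtain ⟨V, hV, hmin⟩ := (isCompact_testChannels pU d D).exists_isMinOn hne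
      ((continuousOn_mutualInfo_testChannel hpU).mono fun _ hV => hV.1)
    refine ⟨V, hV, EReal.coe_le_coe_iff.1 (le_trans ?_ h)⟩
    exact le_iInf fun V' => le_iInf fun hV' => le_iInf fun hVD' =>
      EReal.coe_le_coe_iff.2 (hmin ⟨hV', hVD'⟩)
  · rintro ⟨V, hV, hVb⟩
    exact iInf_le_of_le V (iInf_le_of_le hV.1 (iInf_le_of_le hV.2 (EReal.coe_le_coe_iff.2 hVb)))

theorem rateDistortion_law_le {Ω : Type*} [Fintype Ω] {q : Ω → ℝ} (hq : ∀ ω, 0 ≤ q ω)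
    (X Y : Ω → U) (d : U → U → ℝ) :
    rateDistortion (law q X) d (∑ ω, q ω * d (X ω) (Y ω)) ≤ mutualInfo q X Y := by
  set J := law q fun ω => (X ω, Y ω)
  have hfst (u : U) : law q X u = ∑ v, J (u, v) := by
    rw [← law_fst, law_law]
  choose V hV hJV using fun u : U =>
    have : Nonempty U := ⟨u⟩
    exists_mem_stdSimplex_sum_mul_eq fun v => law_nonneg hq (fun ω => (X ω, Y ω)) (u, v)
  have hVJ (u v : U) : law q X u * V u v = J (u, v) := by rw [hfst, hJV]
  refine (rateDistortion_le_coe_iff (law_nonneg hq X)).2 ⟨V, ⟨hV, ?_⟩, ?_⟩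
  · simp only [hVJ]
    rw [← sum_law_mul q (fun ω => (X ω, Y ω)) fun w => d w.1 w.2, Fintype.sum_prod_type]
  · simp only [hVJ, J, mutualInfo_law, Prod.mk.eta, le_refl]

theorem rateDistortion_le_of_tendsto {ι : Type*} {l : Filter ι} [l.NeBot]
    (hpU : ∀ u, 0 ≤ pU u) {δ β : ι → ℝ} (hδ : limsup (fun k => (δ k : EReal)) l ≤ D)
    (hβ : Tendsto β l (𝓝 b)) (h : ∀ᶠ k in l, rateDistortion pU d (δ k) ≤ (β k : EReal)) :
    rateDistortion pU d D ≤ b := by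
  simp only [rateDistortion_le_coe_iff hpU] at h ⊢
  obtain ⟨V, hV⟩ := h.choice
  let 𝒰 := Ultrafilter.of l
  have h𝒰 : (𝒰 : Filter ι) ≤ l := Ultrafilter.of_le l
  have hV𝒰 := hV.filter_mono h𝒰
  obtain ⟨V₀, hV₀, hlim⟩ := (isCompact_setOf_forall_mem_stdSimplex U U).ultrafilter_le_nhds
    (𝒰.map V) (le_principal_iff.2 (hV𝒰.mono fun k hk => hk.1.1))
  replace hlim : Tendsto V 𝒰 (𝓝 V₀) := hlim
  refine ⟨V₀, ⟨hV₀, ?_⟩, ?_⟩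
  · have hcost : Continuous fun V : U → U → ℝ => ∑ u, ∑ v, pU u * V u v * d u v := by fun_prop
    have hcostlim := (continuous_coe_real_ereal.tendsto _).comp ((hcost.tendsto V₀).comp hlim)
    refine EReal.coe_le_coe_iff.1 (hcostlim.limsup_eq.symm.trans_le (le_trans ?_ hδ))
    exact (limsup_le_limsup (hV𝒰.mono fun k hk => EReal.coe_le_coe_iff.2 hk.1.2)).trans
      (limsup_le_limsup_of_le h𝒰)
  · have hinfo := (continuousOn_mutualInfo_testChannel hpU V₀ hV₀).tendsto.comp
      (tendsto_nhdsWithin_iff.2 ⟨hlim, hV𝒰.mono fun k hk => hk.1.1⟩)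
    exact le_of_tendsto_of_tendsto hinfo (hβ.mono_left h𝒰) (hV𝒰.mono fun k hk => hk.2)

end RateDistortion

/-- A probability mass function on a finite type whose total mass is allowed to be less than one,
as it is for a conditional law given an event of probability zero. -/
def IsSubPMF {α : Type*} [Fintype α] (f : α → ℝ) : Prop := (∀ a, 0 ≤ f a) ∧ ∑ a, f a ≤ 1

theorem isSubPMF_law {Ω α : Type*} [Fintype Ω] [Fintype α] {q : Ω → ℝ}
    (hq : q ∈ stdSimplex ℝ Ω) (X : Ω → α) : IsSubPMF (law q X) :=
  ⟨law_nonneg hq.1 X, (law_mem_stdSimplex hq X).2.le⟩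

theorem isSubPMF_condLaw {Ω α β : Type*} [Fintype Ω] [Fintype α] {q : Ω → ℝ}
    (hq : ∀ ω, 0 ≤ q ω) (X : Ω → α) (Y : Ω → β) (b : β) : IsSubPMF (condLaw q X Y b) := by
  refine ⟨fun a => div_nonneg (law_nonneg hq _ _) (law_nonneg hq _ _), ?_⟩
  simp only [condLaw]
  rw [← Finset.sum_div, sum_law_pair]
  exact div_self_le_one _

theorem IsSubPMF.bind {α β : Type*} [Fintype α] [Fintype β] {f : α → ℝ} {g : α → β → ℝ}
    (hf : IsSubPMF f) (hg : ∀ a, IsSubPMF (g a)) :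
    IsSubPMF fun w : α × β => f w.1 * g w.1 w.2 := by
  refine ⟨fun w => mul_nonneg (hf.1 _) ((hg _).1 _), ?_⟩
  simp only [Fintype.sum_prod_type, ← Finset.mul_sum]
  exact (Finset.sum_le_sum fun a _ => mul_le_of_le_one_right (hf.1 a) (hg a).2).trans hf.2

theorem IsSubPMF.comp_equiv {α β : Type*} [Fintype α] [Fintype β] {f : α → ℝ} (hf : IsSubPMF f)
    (e : β ≃ α) : IsSubPMF fun b => f (e b) :=
  ⟨fun _ => hf.1 _, (e.sum_comp f).trans_le hf.2⟩

section Sequential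

variable {Y Y₁ Y₂ : Type*} {N : ℕ}

theorem past_snoc_castSucc (y : Fin N → Y) (a : Y) (n : Fin N) :
    past (Fin.snoc y a : Fin (N + 1) → Y) n.castSucc = past y n :=
  funext fun j => Fin.snoc_castSucc (α := fun _ => Y) a y (Fin.castLE n.isLt.le j)

theorem past_snoc_last (y : Fin N → Y) (a : Y) :
    past (Fin.snoc y a : Fin (N + 1) → Y) (Fin.last N) = y :=
  funext fun j => Fin.snoc_castSucc (α := fun _ => Y) a y j

variable [Fintype Y] [Fintype Y₁] [Fintype Y₂]

theorem sum_prod_past_succ (k : (n : Fin (N + 1)) → (Fin (n : ℕ) → Y) → Y → ℝ) :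
    ∑ y : Fin (N + 1) → Y, ∏ n, k n (past y n) (y n) =
      ∑ y : Fin N → Y, (∏ n : Fin N, k n.castSucc (past y n) (y n)) *
        ∑ a, k (Fin.last N) y a := by
  rw [← (Fin.snocEquiv fun _ => Y).sum_comp, Fintype.sum_prod_type, Finset.sum_comm]
  refine Finset.sum_congr rfl fun y _ => ?_
  rw [Finset.mul_sum]
  refine Finset.sum_congr rfl fun a _ => ?_
  rw [Fin.prod_univ_castSucc]
  simp [Fin.snocEquiv, past_snoc_castSucc, past_snoc_last]

theorem sum_prod_past (k : (n : Fin N) → (Fin (n : ℕ) → Y) → Y → ℝ) (s : Fin N → ℝ)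
    (hk : ∀ n h, ∑ y, k n h y = s n) :
    ∑ y : Fin N → Y, ∏ n, k n (past y n) (y n) = ∏ n, s n := by
  induction N with
  | zero => simp
  | succ N ih =>
    have hlast (y : Fin N → Y) : ∑ a, k (Fin.last N) y a = s (Fin.last N) := hk (Fin.last N) y
    simp only [sum_prod_past_succ, hlast]
    rw [← Finset.sum_mul, ih _ (fun n => s n.castSucc) fun n => hk n.castSucc,
      Fin.prod_univ_castSucc]

theorem sum_prod_past_pair
    (k : (n : Fin N) → (Fin (n : ℕ) → Y₁) → (Fin (n : ℕ) → Y₂) → Y₁ × Y₂ → ℝ) (s : Fin N → ℝ)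
    (hk : ∀ n h₁ h₂, ∑ y, k n h₁ h₂ y = s n) :
    ∑ y : (Fin N → Y₁) × (Fin N → Y₂), ∏ n, k n (past y.1 n) (past y.2 n) (y.1 n, y.2 n) =
      ∏ n, s n := by
  rw [← sum_prod_past (fun n (h : Fin (n : ℕ) → Y₁ × Y₂) y =>
    k n (fun j => (h j).1) (fun j => (h j).2) y) s fun n h => hk n _ _]
  exact (Fintype.sum_equiv (Equiv.arrowProdEquivProdArrow (Fin N) (fun _ => Y₁) fun _ => Y₂)
    _ _ fun _ => rfl).symm

theorem IsSubPMF.prod_past {k : (n : Fin N) → (Fin (n : ℕ) → Y) → Y → ℝ}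
    (hk : ∀ n h, IsSubPMF (k n h)) :
    IsSubPMF fun y : Fin N → Y => ∏ n, k n (past y n) (y n) := by
  refine ⟨fun y => Finset.prod_nonneg fun n _ => (hk n _).1 _, ?_⟩
  induction N with
  | zero => simp
  | succ N ih =>
    rw [sum_prod_past_succ]
    refine le_trans (Finset.sum_le_sum fun y _ => mul_le_of_le_one_right ?_ (hk (Fin.last N) y).2)
      (ih fun n => hk n.castSucc)
    exact Finset.prod_nonneg fun n _ => (hk n.castSucc _).1 _

theorem IsSubPMF.prod {k : Fin N → Y → ℝ} (hk : ∀ n, IsSubPMF (k n)) :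
    IsSubPMF fun y : Fin N → Y => ∏ n, k n (y n) :=
  IsSubPMF.prod_past (k := fun n _ => k n) fun n _ => hk n

end Sequential

theorem law_iid_pair {U₁ U₂ : Type*} [Fintype U₁] [Fintype U₂] {K : ℕ} {p : U₁ × U₂ → ℝ}
    (hp : ∑ w, p w = 1) (m : Fin K) :
    law (fun u : (Fin K → U₁) × (Fin K → U₂) => ∏ j, p (u.1 j, u.2 j))
      (fun u => (u.1 m, u.2 m)) = p := by
  classical
  funext v
  have h := sum_prod_past_pair (N := K)
    (fun j _ _ w => p w * if j = m then if w = v then 1 else 0 else 1)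
    (fun j => if j = m then p v else 1) fun j _ _ => by split_ifs <;> simp [hp]
  simp only [Finset.prod_mul_distrib, Finset.prod_ite_eq', Finset.mem_univ, if_true] at h
  simpa [law] using h

namespace Code

variable {U₁ U₂ X₁ X₂ Y₁ Y₂ : Type*} {K N : ℕ}
  {ps : U₁ × U₂ → ℝ} {W : X₁ × X₂ → Y₁ × Y₂ → ℝ}

/-- The pair of source letters at the time `w.2`. Under `prodUniform` this is the pair of letters
at a uniformly random time; the same holds for `inputAt`, `outputAt` and `estimateAt₁`. -/
def sourceAt (w : Outcome U₁ U₂ Y₁ Y₂ K N × Fin K) : U₁ × U₂ := (w.1.1.1 w.2, w.1.1.2 w.2)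

/-- The pair of channel inputs at the time `w.2`. -/
def inputAt (c : Code U₁ U₂ X₁ X₂ Y₁ Y₂ K N) (w : Outcome U₁ U₂ Y₁ Y₂ K N × Fin N) : X₁ × X₂ :=
  c.input w.1 w.2

/-- The pair of channel outputs at the time `w.2`. -/
def outputAt (w : Outcome U₁ U₂ Y₁ Y₂ K N × Fin N) : Y₁ × Y₂ := (w.1.2.1 w.2, w.1.2.2 w.2)

/-- The estimate at terminal 2 of the letter of the first source at the time `w.2`. -/
def estimateAt₁ (c : Code U₁ U₂ X₁ X₂ Y₁ Y₂ K N) (w : Outcome U₁ U₂ Y₁ Y₂ K N × Fin K) : U₁ :=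
  c.dec₂ w.1.1.2 w.1.2.2 w.2

variable [Fintype Y₁] [Fintype Y₂]

theorem sum_prod_channel (c : Code U₁ U₂ X₁ X₂ Y₁ Y₂ K N) (hW : ∀ x, ∑ y, W x y = 1)
    (u : (Fin K → U₁) × (Fin K → U₂)) :
    ∑ y : (Fin N → Y₁) × (Fin N → Y₂), ∏ n, W (c.input (u, y) n) (y.1 n, y.2 n) = 1 :=
  (sum_prod_past_pair (fun n h₁ h₂ => W (c.enc₁ n u.1 h₁, c.enc₂ n u.2 h₂)) (fun _ => 1)
    fun _ _ _ => hW _).trans Finset.prod_const_one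

variable [Fintype U₁] [Fintype U₂] (c : Code U₁ U₂ X₁ X₂ Y₁ Y₂ K N)

theorem law_prob_fst (hW : ∀ x, ∑ y, W x y = 1) :
    law (c.prob ps W) Prod.fst = fun u => ∏ m, ps (u.1 m, u.2 m) := by
  funext u
  simp only [law_fst, prob]
  rw [← Finset.mul_sum, c.sum_prod_channel hW, mul_one]

theorem prob_nonneg (hps : ps ∈ stdSimplex ℝ (U₁ × U₂)) (hW : ∀ x, W x ∈ stdSimplex ℝ (Y₁ × Y₂))
    (ω : Outcome U₁ U₂ Y₁ Y₂ K N) : 0 ≤ c.prob ps W ω :=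
  mul_nonneg (Finset.prod_nonneg fun _ _ => hps.1 _) (Finset.prod_nonneg fun _ _ => (hW _).1 _)

theorem prob_mem_stdSimplex (hps : ps ∈ stdSimplex ℝ (U₁ × U₂))
    (hW : ∀ x, W x ∈ stdSimplex ℝ (Y₁ × Y₂)) :
    c.prob ps W ∈ stdSimplex ℝ (Outcome U₁ U₂ Y₁ Y₂ K N) := by
  refine ⟨c.prob_nonneg hps hW, ?_⟩
  rw [← sum_law _ Prod.fst, c.law_prob_fst fun x => (hW x).2]
  exact (sum_prod_past_pair (fun _ _ _ => ps) (fun _ => 1) fun _ _ _ => hps.2).trans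
    Finset.prod_const_one

theorem law_source (hps : ∑ u, ps u = 1) (hW : ∀ x, ∑ y, W x y = 1) (m : Fin K) :
    law (c.prob ps W) (fun ω => sourceAt (ω, m)) = ps := by
  have h := law_law (c.prob ps W) Prod.fst fun u => (u.1 m, u.2 m)
  exact h.symm.trans ((c.law_prob_fst hW).symm ▸ law_iid_pair hps m)

theorem law_prodUniform_source [NeZero K] (hps : ∑ u, ps u = 1) (hW : ∀ x, ∑ y, W x y = 1) :
    law (prodUniform (c.prob ps W) (Fin K)) sourceAt = ps := by
  funext u
  simp only [law_prodUniform, c.law_source hps hW, Finset.sum_const, Finset.card_univ,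
    nsmul_eq_mul]
  field_simp

theorem sum_prob_mul_eq_zero (hW : ∀ x, ∑ y, W x y = 1) (n : Fin N)
    {g : X₁ × X₂ → Y₁ × Y₂ → ℝ} (hg : ∀ x, ∑ y, W x y * g x y = 0) :
    ∑ ω, c.prob ps W ω * g (c.inputAt (ω, n)) (outputAt (ω, n)) = 0 := by
  rw [Fintype.sum_prod_type]
  refine Finset.sum_eq_zero fun u _ => ?_
  have h := sum_prod_past_pair (fun j h₁ h₂ y => W (c.enc₁ j u.1 h₁, c.enc₂ j u.2 h₂) y *
      if j = n then g (c.enc₁ j u.1 h₁, c.enc₂ j u.2 h₂) y else 1)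
    (fun j => if j = n then 0 else 1) fun j h₁ h₂ => by split_ifs <;> simp [hg, hW]
  simp only [Finset.prod_mul_distrib, Finset.prod_ite_eq', Finset.mem_univ, if_true] at h
  simp only [prob, mul_assoc, ← Finset.mul_sum]
  exact mul_eq_zero_of_right _ h

theorem law_input_output (hW : ∀ x, ∑ y, W x y = 1) (n : Fin N) :
    law (c.prob ps W) (fun ω => (c.inputAt (ω, n), outputAt (ω, n))) =
      inputOutput (law (c.prob ps W) fun ω => c.inputAt (ω, n)) W := by
  classical
  funext ⟨x, y⟩
  have h := c.sum_prob_mul_eq_zero (ps := ps) hW n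
    (g := fun x' y' => if x' = x then (if y' = y then 1 else 0) - W x y else 0) fun x' => by
      split_ifs with hx
      · simp [mul_sub, ← Finset.sum_mul, hW, hx]
      · simp
  simp only [inputOutput, law, Finset.sum_mul]
  rw [← sub_eq_zero, ← Finset.sum_sub_distrib]
  refine (Finset.sum_congr rfl fun ω _ => ?_).trans h
  by_cases hx : c.inputAt (ω, n) = x <;> simp [hx, mul_sub]

/-- The law of the pair of channel inputs at a uniformly random time. -/
noncomputable def avgInput (ps : U₁ × U₂ → ℝ) (W : X₁ × X₂ → Y₁ × Y₂ → ℝ) : X₁ × X₂ → ℝ :=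
  law (prodUniform (c.prob ps W) (Fin N)) c.inputAt

theorem avgInput_mem_stdSimplex [Fintype X₁] [Fintype X₂] [NeZero N]
    (hps : ps ∈ stdSimplex ℝ (U₁ × U₂)) (hW : ∀ x, W x ∈ stdSimplex ℝ (Y₁ × Y₂)) :
    c.avgInput ps W ∈ stdSimplex ℝ (X₁ × X₂) :=
  law_mem_stdSimplex (prodUniform_mem_stdSimplex (c.prob_mem_stdSimplex hps hW)) _

theorem law_prodUniform_input_output (hW : ∀ x, ∑ y, W x y = 1) :
    law (prodUniform (c.prob ps W) (Fin N)) (fun w => (c.inputAt w, outputAt w)) =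
      inputOutput (c.avgInput ps W) W := by
  funext w
  simp only [law_prodUniform, c.law_input_output hW, inputOutput, avgInput, ← Finset.sum_mul,
    div_mul_eq_mul_div]

theorem condLaw_prodUniform_output (hps : ps ∈ stdSimplex ℝ (U₁ × U₂))
    (hW : ∀ x, W x ∈ stdSimplex ℝ (Y₁ × Y₂)) {ω : Outcome U₁ U₂ Y₁ Y₂ K N}
    (hω : 0 < c.prob ps W ω) (n : Fin N) :
    condLaw (prodUniform (c.prob ps W) (Fin N)) outputAt c.inputAt (c.inputAt (ω, n)) =
      W (c.inputAt (ω, n)) := by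
  funext y
  have hpos := law_pos (prodUniform_nonneg (c.prob_nonneg hps hW)) c.inputAt
    (prodUniform_pos hω n)
  have hswap := law_injective_comp Prod.swap_injective (prodUniform (c.prob ps W) (Fin N))
    (fun w => (c.inputAt w, outputAt w)) (c.inputAt (ω, n), y)
  rw [c.law_prodUniform_input_output fun x => (hW x).2] at hswap
  exact (div_eq_iff hpos.ne').2 (hswap.trans (mul_comm _ _))

/-- The measure on the outcomes that draws `U₂` from `p₂`, `Y₂` from `Q` given `X₂`, then `U₁` from
`G` given its estimate and `Y₁` from `V` given `X₁`, `Y₂` and `X₂`, letter by letter. The law of a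
transmission is compared with it in Gibbs' inequality. -/
def testPMF (G : U₁ → U₁ → ℝ) (p₂ : U₂ → ℝ) (V : X₁ × Y₂ × X₂ → Y₁ → ℝ) (Q : X₂ → Y₂ → ℝ)
    (ω : Outcome U₁ U₂ Y₁ Y₂ K N) : ℝ :=
  (∏ m, G (c.estimateAt₁ (ω, m)) (sourceAt (ω, m)).1 * p₂ (sourceAt (ω, m)).2) *
    ∏ n, V ((c.inputAt (ω, n)).1, (outputAt (ω, n)).2, (c.inputAt (ω, n)).2) (outputAt (ω, n)).1 *
      Q (c.inputAt (ω, n)).2 (outputAt (ω, n)).2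

theorem isSubPMF_testPMF {G : U₁ → U₁ → ℝ} {p₂ : U₂ → ℝ} {V : X₁ × Y₂ × X₂ → Y₁ → ℝ}
    {Q : X₂ → Y₂ → ℝ} (hG : ∀ v, IsSubPMF (G v)) (hp₂ : IsSubPMF p₂)
    (hV : ∀ z, IsSubPMF (V z)) (hQ : ∀ x, IsSubPMF (Q x)) :
    IsSubPMF (c.testPMF G p₂ V Q) := by
  let e : Outcome U₁ U₂ Y₁ Y₂ K N ≃
      (Fin K → U₂) × (Fin N → Y₂) × (Fin K → U₁) × (Fin N → Y₁) :=
    ⟨fun ω => (ω.1.2, ω.2.2, ω.1.1, ω.2.1), fun v => ((v.2.2.1, v.1), (v.2.2.2, v.2.1)),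
      fun _ => rfl, fun _ => rfl⟩
  have hordered := (IsSubPMF.prod (N := K) fun _ => hp₂).bind fun u₂ =>
    (IsSubPMF.prod_past fun (n : Fin N) h => hQ (c.enc₂ n u₂ h)).bind fun y₂ =>
      (IsSubPMF.prod fun m => hG (c.dec₂ u₂ y₂ m)).bind fun u₁ =>
        IsSubPMF.prod_past fun (n : Fin N) h =>
          hV (c.enc₁ n u₁ h, y₂ n, c.enc₂ n u₂ (past y₂ n))
  convert hordered.comp_equiv e using 1
  funext ω
  simp only [e, testPMF, estimateAt₁, sourceAt, inputAt, outputAt, input,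
    Finset.prod_mul_distrib, Equiv.coe_fn_mk]
  ring

theorem source_mul_exp_infoDensity_sub [NeZero K] (hps : ps ∈ stdSimplex ℝ (U₁ × U₂))
    (hW : ∀ x, W x ∈ stdSimplex ℝ (Y₁ × Y₂)) {ω : Outcome U₁ U₂ Y₁ Y₂ K N}
    (hω : 0 < c.prob ps W ω) (m : Fin K) :
    let q := prodUniform (c.prob ps W) (Fin K)
    ps (sourceAt (ω, m)) *
        Real.exp (infoDensity q (fun w => (sourceAt w).1) c.estimateAt₁ (ω, m) -
          infoDensity q (fun w => (sourceAt w).1) (fun w => (sourceAt w).2) (ω, m)) =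
      condLaw q (fun w => (sourceAt w).1) c.estimateAt₁ (c.estimateAt₁ (ω, m))
        (sourceAt (ω, m)).1 * law q (fun w => (sourceAt w).2) (sourceAt (ω, m)).2 := by
  intro q
  rw [← law_mul_exp_infoDensity_sub (prodUniform_nonneg (c.prob_nonneg hps hW))
    (fun w => (sourceAt w).1) (fun w => (sourceAt w).2) c.estimateAt₁ (prodUniform_pos hω m)]
  exact congrArg (· * _) (congrFun (c.law_prodUniform_source hps.2 fun x => (hW x).2).symm _)

theorem channel_mul_exp_neg_condInfoDensity (hps : ps ∈ stdSimplex ℝ (U₁ × U₂))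
    (hW : ∀ x, W x ∈ stdSimplex ℝ (Y₁ × Y₂)) {ω : Outcome U₁ U₂ Y₁ Y₂ K N}
    (hω : 0 < c.prob ps W ω) (n : Fin N) :
    let q := prodUniform (c.prob ps W) (Fin N)
    W (c.inputAt (ω, n)) (outputAt (ω, n)) *
        Real.exp (-condInfoDensity q (fun w => (c.inputAt w).1) (fun w => (outputAt w).2)
          (fun w => (c.inputAt w).2) (ω, n)) =
      condLaw q (fun w => (outputAt w).1)
          (fun w => ((c.inputAt w).1, (outputAt w).2, (c.inputAt w).2))
          ((c.inputAt (ω, n)).1, (outputAt (ω, n)).2, (c.inputAt (ω, n)).2) (outputAt (ω, n)).1 *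
        condLaw q (fun w => (outputAt w).2) (fun w => (c.inputAt w).2) (c.inputAt (ω, n)).2
          (outputAt (ω, n)).2 := by
  intro q
  rw [← condLaw_mul_exp_neg_condInfoDensity (prodUniform_nonneg (c.prob_nonneg hps hW))
    (fun w => (outputAt w).1) (fun w => (c.inputAt w).1) (fun w => (outputAt w).2)
    (fun w => (c.inputAt w).2) (prodUniform_pos hω n), ← c.condLaw_prodUniform_output hps hW hω n]

/-- The logarithm of the law of a transmission relative to `testPMF`, when the kernels of `testPMF`
are the conditional laws of the letters at a uniformly random time. -/
noncomputable def testLogRatio (ps : U₁ × U₂ → ℝ) (W : X₁ × X₂ → Y₁ × Y₂ → ℝ)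
    (ω : Outcome U₁ U₂ Y₁ Y₂ K N) : ℝ :=
  let qK := prodUniform (c.prob ps W) (Fin K)
  let qN := prodUniform (c.prob ps W) (Fin N)
  ∑ m, infoDensity qK (fun w => (sourceAt w).1) (fun w => (sourceAt w).2) (ω, m) -
    ∑ m, infoDensity qK (fun w => (sourceAt w).1) c.estimateAt₁ (ω, m) +
    ∑ n, condInfoDensity qN (fun w => (c.inputAt w).1) (fun w => (outputAt w).2)
      (fun w => (c.inputAt w).2) (ω, n)

theorem exists_isSubPMF_prob_mul_exp_neg_le [NeZero K] (hps : ps ∈ stdSimplex ℝ (U₁ × U₂))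
    (hW : ∀ x, W x ∈ stdSimplex ℝ (Y₁ × Y₂)) :
    ∃ Q : Outcome U₁ U₂ Y₁ Y₂ K N → ℝ, IsSubPMF Q ∧
      ∀ ω, c.prob ps W ω * Real.exp (-c.testLogRatio ps W ω) ≤ Q ω := by
  have hP := c.prob_mem_stdSimplex hps hW
  set qK := prodUniform (c.prob ps W) (Fin K)
  set qN := prodUniform (c.prob ps W) (Fin N)
  have hqN : ∀ w, 0 ≤ qN w := prodUniform_nonneg hP.1
  have hqK : qK ∈ stdSimplex ℝ (Outcome U₁ U₂ Y₁ Y₂ K N × Fin K) := prodUniform_mem_stdSimplex hP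
  have hQ := c.isSubPMF_testPMF
    (isSubPMF_condLaw hqK.1 (fun w => (sourceAt w).1) c.estimateAt₁)
    (isSubPMF_law hqK fun w => (sourceAt w).2)
    (isSubPMF_condLaw hqN (fun w => (outputAt w).1)
      fun w => ((c.inputAt w).1, (outputAt w).2, (c.inputAt w).2))
    (isSubPMF_condLaw hqN (fun w => (outputAt w).2) fun w => (c.inputAt w).2)
  refine ⟨_, hQ, fun ω => ?_⟩
  rcases (hP.1 ω).eq_or_lt with hω | hω
  · rw [← hω, zero_mul]
    exact hQ.1 ω
  refine le_of_eq ?_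
  simp only [testPMF, ← c.source_mul_exp_infoDensity_sub hps hW hω,
    ← c.channel_mul_exp_neg_condInfoDensity hps hW hω, qK, qN]
  rw [Finset.prod_mul_distrib, Finset.prod_mul_distrib, mul_mul_mul_comm, ← Real.exp_sum,
    ← Real.exp_sum, ← Real.exp_add, Finset.sum_sub_distrib, Finset.sum_neg_distrib, testLogRatio,
    neg_add, neg_sub]
  rfl

variable [Fintype X₁] [Fintype X₂]

theorem mutualInfo_sourceAt_estimateAt₁_le [NeZero K] (hps : ps ∈ stdSimplex ℝ (U₁ × U₂))
    (hW : ∀ x, W x ∈ stdSimplex ℝ (Y₁ × Y₂)) :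
    mutualInfo (prodUniform (c.prob ps W) (Fin K)) (fun w => (sourceAt w).1) c.estimateAt₁ ≤
      mutualInfo ps Prod.fst Prod.snd + N / K * condMutualInfo (inputOutput (c.avgInput ps W) W)
        (fun w => w.1.1) (fun w => w.2.2) (fun w => w.1.2) := by
  have hP := c.prob_mem_stdSimplex hps hW
  obtain ⟨Q, hQ, hPQ⟩ := c.exists_isSubPMF_prob_mul_exp_neg_le hps hW
  have hgibbs := sum_mul_nonneg_of_mul_exp_neg_le hP.1 (hQ.2.trans_eq hP.2.symm) hPQ
  have hsource := mutualInfo_law (prodUniform (c.prob ps W) (Fin K)) sourceAt Prod.fst Prod.snd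
  have hchannel := condMutualInfo_law (prodUniform (c.prob ps W) (Fin N))
    (fun w => (c.inputAt w, outputAt w)) (fun w => w.1.1) (fun w => w.2.2) fun w => w.1.2
  rw [c.law_prodUniform_source hps.2 fun x => (hW x).2] at hsource
  rw [c.law_prodUniform_input_output fun x => (hW x).2] at hchannel
  simp only [testLogRatio, mul_add, mul_sub, Finset.sum_add_distrib, Finset.sum_sub_distrib,
    ← card_mul_sum_prodUniform_mul, ← mutualInfo_eq_sum, ← condMutualInfo_eq_sum,
    Fintype.card_fin] at hgibbs
  have hK : (0 : ℝ) < K := Nat.cast_pos.2 (Nat.pos_of_neZero K)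
  rw [hsource, hchannel]
  field_simp
  linarith

theorem rateDistortion_distortion₁_le [NeZero K] (hps : ps ∈ stdSimplex ℝ (U₁ × U₂))
    (hW : ∀ x, W x ∈ stdSimplex ℝ (Y₁ × Y₂)) (d₁ : U₁ → U₁ → ℝ) :
    rateDistortion (law ps Prod.fst) d₁ (c.distortion₁ ps W d₁) ≤
      ((mutualInfo ps Prod.fst Prod.snd + N / K *
        condMutualInfo (inputOutput (c.avgInput ps W) W)
          (fun w => w.1.1) (fun w => w.2.2) (fun w => w.1.2) : ℝ) : EReal) := by
  set q := prodUniform (c.prob ps W) (Fin K)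
  have hlaw : law q (fun w => (sourceAt w).1) = law ps Prod.fst := by
    rw [← law_law q sourceAt Prod.fst, c.law_prodUniform_source hps.2 fun x => (hW x).2]
  have hdist : ∑ w, q w * d₁ (sourceAt w).1 (c.estimateAt₁ w) = c.distortion₁ ps W d₁ := by
    have h := card_mul_sum_prodUniform_mul (ι := Fin K) (c.prob ps W)
      fun w => d₁ (sourceAt w).1 (c.estimateAt₁ w)
    simp only [distortion₁, seqDistortion, mul_left_comm _ (K : ℝ)⁻¹, ← Finset.mul_sum]
    rw [eq_inv_mul_iff_mul_eq₀ (Nat.cast_ne_zero.2 (NeZero.ne K))]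
    rw [Fintype.card_fin] at h
    exact h
  rw [← hlaw, ← hdist]
  exact (rateDistortion_law_le (prodUniform_nonneg (c.prob_nonneg hps hW)) _ _ d₁).trans
    (EReal.coe_le_coe_iff.2 (c.mutualInfo_sourceAt_estimateAt₁_le hps hW))

/-- The code with the roles of the terminals exchanged, by which the bounds for terminal 2 carry
over to terminal 1. -/
def swap (c : Code U₁ U₂ X₁ X₂ Y₁ Y₂ K N) : Code U₂ U₁ X₂ X₁ Y₂ Y₁ K N :=
  ⟨c.enc₂, c.enc₁, c.dec₂, c.dec₁⟩

/-- The exchange of the terminals in an outcome; it turns outcomes of `c.swap` into outcomes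
of `c`. -/
def swapOutcome (U₁ U₂ Y₁ Y₂ : Type*) (K N : ℕ) :
    Outcome U₂ U₁ Y₂ Y₁ K N ≃ Outcome U₁ U₂ Y₁ Y₂ K N :=
  (Equiv.prodComm _ _).prodCongr (Equiv.prodComm _ _)

omit [Fintype X₁] [Fintype X₂] in
theorem swap_distortion₁ (d₂ : U₂ → U₂ → ℝ) :
    c.swap.distortion₁ (fun w => ps w.swap) (fun x y => W x.swap y.swap) d₂ =
      c.distortion₂ ps W d₂ :=
  Fintype.sum_equiv (swapOutcome U₁ U₂ Y₁ Y₂ K N) _ _ fun _ => rfl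

omit [Fintype X₁] [Fintype X₂] in
theorem swap_avgInput :
    c.swap.avgInput (fun w => ps w.swap) (fun x y => W x.swap y.swap) =
      fun x => c.avgInput ps W x.swap := by
  let e := (swapOutcome U₁ U₂ Y₁ Y₂ K N).prodCongr (Equiv.refl (Fin N))
  have h := comp_equiv_eq_law e (prodUniform (c.prob ps W) (Fin N))
  funext x
  calc law (fun w => prodUniform (c.prob ps W) (Fin N) (e w)) c.swap.inputAt x
      = law (prodUniform (c.prob ps W) (Fin N)) (fun w => (c.inputAt w).swap) x := by
        rw [h, law_law]
        rfl
    _ = c.avgInput ps W x.swap :=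
        law_injective_comp Prod.swap_injective _ c.inputAt x.swap

theorem rateDistortion_distortion₂_le [NeZero K] (hps : ps ∈ stdSimplex ℝ (U₁ × U₂))
    (hW : ∀ x, W x ∈ stdSimplex ℝ (Y₁ × Y₂)) (d₂ : U₂ → U₂ → ℝ) :
    rateDistortion (law ps Prod.snd) d₂ (c.distortion₂ ps W d₂) ≤
      ((mutualInfo ps Prod.fst Prod.snd + N / K *
        condMutualInfo (inputOutput (c.avgInput ps W) W)
          (fun w => w.1.2) (fun w => w.2.1) (fun w => w.1.1) : ℝ) : EReal) := by
  have hps_swap : (fun w : U₂ × U₁ => ps w.swap) = law ps Prod.swap :=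
    comp_equiv_eq_law (Equiv.prodComm U₂ U₁) ps
  have hW_swap (x : X₂ × X₁) : (fun y : Y₂ × Y₁ => W x.swap y.swap) = law (W x.swap) Prod.swap :=
    comp_equiv_eq_law (Equiv.prodComm Y₂ Y₁) (W x.swap)
  have hio_swap : inputOutput (fun x => c.avgInput ps W x.swap) (fun x y => W x.swap y.swap) =
      law (inputOutput (c.avgInput ps W) W) fun w => (w.1.swap, w.2.swap) :=
    comp_equiv_eq_law ((Equiv.prodComm X₂ X₁).prodCongr (Equiv.prodComm Y₂ Y₁))
      (inputOutput (c.avgInput ps W) W)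
  have h := c.swap.rateDistortion_distortion₁_le
    (hps_swap ▸ law_mem_stdSimplex hps _) (fun x => hW_swap x ▸ law_mem_stdSimplex (hW _) _) d₂
  rw [swap_distortion₁, swap_avgInput, hio_swap, hps_swap, law_law, mutualInfo_law,
    mutualInfo_comm, condMutualInfo_law] at h
  exact h

end Code

open Filter Topology in
theorem tendsto_condMutualInfo_inputOutput {X₁ X₂ Y₁ Y₂ α β γ ι : Type*} [Fintype X₁]
    [Fintype X₂] [Fintype Y₁] [Fintype Y₂] [Fintype α] [Fintype β] [Fintype γ] {l : Filter ι}
    {p : ι → X₁ × X₂ → ℝ} {p₀ : X₁ × X₂ → ℝ} {W : X₁ × X₂ → Y₁ × Y₂ → ℝ}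
    (hW : ∀ x y, 0 ≤ W x y) (hp : Tendsto p l (𝓝[Set.Ici 0] p₀)) (hp₀ : 0 ≤ p₀)
    (X : (X₁ × X₂) × (Y₁ × Y₂) → α) (Y : (X₁ × X₂) × (Y₁ × Y₂) → β)
    (Z : (X₁ × X₂) × (Y₁ × Y₂) → γ) :
    Tendsto (fun k => condMutualInfo (inputOutput (p k) W) X Y Z) l
      (𝓝 (condMutualInfo (inputOutput p₀ W) X Y Z)) := by
  have hio : Continuous fun p => inputOutput p W := by
    unfold inputOutput
    fun_prop
  have hcont := (continuousOn_condMutualInfo X Y Z).comp hio.continuousOn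
    fun (p : X₁ × X₂ → ℝ) (hp : 0 ≤ p) w => mul_nonneg (hp w.1) (hW w.1 w.2)
  exact (hcont p₀ hp₀).tendsto.comp hp

end TWC

open TWC Filter Topology in
theorem lemma2 {U₁ U₂ X₁ X₂ Y₁ Y₂ : Type*}
    [Fintype U₁] [Fintype U₂] [Fintype X₁] [Fintype X₂] [Fintype Y₁] [Fintype Y₂]
    (ps : U₁ × U₂ → ℝ) (hps : ps ∈ stdSimplex ℝ (U₁ × U₂))
    (W : X₁ × X₂ → Y₁ × Y₂ → ℝ) (hW : ∀ x, W x ∈ stdSimplex ℝ (Y₁ × Y₂))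
    (d₁ : U₁ → U₁ → ℝ) (d₂ : U₂ → U₂ → ℝ) (r D₁ D₂ : ℝ) (hr : 0 < r)
    (hD : TWC.Achievable ps W d₁ d₂ r D₁ D₂) :
    ∃ p ∈ stdSimplex ℝ (X₁ × X₂),
      TWC.rateDistortion (TWC.law ps Prod.fst) d₁ D₁ ≤
        ((TWC.mutualInfo ps Prod.fst Prod.snd + r⁻¹ *
          TWC.condMutualInfo (TWC.inputOutput p W)
            (fun w => w.1.1) (fun w => w.2.2) (fun w => w.1.2) : ℝ) : EReal) ∧
      TWC.rateDistortion (TWC.law ps Prod.snd) d₂ D₂ ≤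
        ((TWC.mutualInfo ps Prod.fst Prod.snd + r⁻¹ *
          TWC.condMutualInfo (TWC.inputOutput p W)
            (fun w => w.1.2) (fun w => w.2.1) (fun w => w.1.1) : ℝ) : EReal) := by
  obtain ⟨N, c, hN, hratio, hD₁, hD₂⟩ := hD
  have (K : ℕ) : NeZero (N K) := ⟨(hN K).ne'⟩
  have havg (K : ℕ) := (c K).avgInput_mem_stdSimplex hps hW
  let 𝒰 := hyperfilter ℕ
  have h𝒰 : (𝒰 : Filter ℕ) ≤ atTop := Nat.hyperfilter_le_atTop
  obtain ⟨p, hp, hlim⟩ := (isCompact_stdSimplex ℝ (X₁ × X₂)).ultrafilter_le_nhds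
    (𝒰.map fun K => (c K).avgInput ps W) (tendsto_principal.2 (.of_forall havg))
  have havg_lim : Tendsto (fun K => (c K).avgInput ps W) 𝒰 (𝓝[Set.Ici 0] p) :=
    tendsto_nhdsWithin_iff.2 ⟨hlim, .of_forall fun K => (havg K).1⟩
  have hratio_inv : Tendsto (fun K : ℕ => (N K : ℝ) / K) 𝒰 (𝓝 r⁻¹) := by
    simpa only [inv_div] using (hratio.mono_left h𝒰).inv₀ hr.ne'
  have hK : ∀ᶠ K : ℕ in 𝒰, NeZero K := h𝒰 ((eventually_ne_atTop 0).mono fun K hK => ⟨hK⟩)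
  refine ⟨p, hp, ?_, ?_⟩
  · exact rateDistortion_le_of_tendsto (law_nonneg hps.1 _)
      ((limsup_le_limsup_of_le h𝒰).trans hD₁) (tendsto_const_nhds.add (hratio_inv.mul
        (tendsto_condMutualInfo_inputOutput (fun x => (hW x).1) havg_lim hp.1 _ _ _)))
      (hK.mono fun K _ => (c K).rateDistortion_distortion₁_le hps hW d₁)
  · exact rateDistortion_le_of_tendsto (law_nonneg hps.1 _)
      ((limsup_le_limsup_of_le h𝒰).trans hD₂) (tendsto_const_nhds.add (hratio_inv.mul
        (tendsto_condMutualInfo_inputOutput (fun x => (hW x).1) havg_lim hp.1 _ _ _)))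
      (hK.mono fun K _ => (c K).rateDistortion_distortion₂_le hps hW d₂)
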